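/- **Theorem (convergence of algorithm).** Let $S\subset\mathbb{R}^d$ be nonempty and closed, and let $\mathrm{usc\text{-}fcns}(S)$ be the set of upper semicontinuous functions $f:S\to[-\infty,\infty]$ with $f\not\equiv-\infty$. For such $f$ let $\mathrm{hypo}\, f=\{(x,\alpha)\in S\times\mathbb{R} : f(x)\ge\alpha\}$. Fix a point $\bar c\in S\times\mathbb{R}$ and equip $\mathbb{R}^d\times\mathbb{R}$ with the norm $\|(x,\alpha)\|=\max\{\|x\|_2,|\alpha|\}$. Equip $\mathrm{usc\text{-}fcns}(S)$ with the aw-distance (Attouch–Wets distance) $$d(f,g)=\int_0^\infty \max_{\|z-\bar c\|\le\rho}\big|\mathrm{dist}(z,\mathrm{hypo}\, f)-\mathrm{dist}(z,\mathrm{hypo}\, g)\big|\,e^{-\rho}\,d\rho .$$ All topological notions below refer to this metric (the topology does not depend on the choice of $\bar c$ or of the norm). For sets $A^\nu$, $\nu\in\mathbb{N}$, in a metric space, let $\mathrm{OutLim}\,A^\nu$ be the set of limits of convergent sequences $(a_k)_{k\in\mathbb N}$ with $a_k\in A^{\nu_k}$ for some $\nu_1<\nu_2<\cdots$, and let $\mathrm{InnLim}\,A^\nu$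 be the set of limits of convergent sequences $(a^\nu)_{\nu\in\mathbb N}$ with $a^\nu\in A^\nu$ for all large $\nu$. Write $A^\nu\to A$ (set-convergence) if both limits equal $A$. For a set $G$, $\varphi:G\to[-\infty,\infty]$ and $\delta\in\mathbb{R}$, let $\delta\text{-}\mathrm{argmin}_{f\in G}\,\varphi(f)=\{f\in G : \varphi(f)\le \inf_{g\in G}\varphi(g)+\delta\}$. Let $n\ge 1$, $x^1,\dots,x^n\in\mathbb{R}^{d_0}$, and let $F\subset F^0\subset\mathrm{usc\text{-}fcns}(S)$ with $F$ and $F^0$ closed. Let $\psi(x^j,\cdot):F^0\to(-\infty,\infty]$ be continuous for every $j$, and let $\pi,\pi^\nu:F^0\to\mathbb{R}$, $\nu\in\mathbb{N}$, be such that $\pi^\nu(g^\nu)\to\pi(g)$ whenever $g^\nu\in F^0$ and $g^\nu\to g$. Let $\epsilon^\nu\ge 0$ with $\epsilon^\nu\to\epsilon^\infty\in\mathbb{R}$, let $F^\nu\subset F^0$ with $F^\nu\to F$, let $\epsilon\in\mathbb{R}$, and let $(f^\nu)_{\nu\in\mathbb{N}}$ be iterates of the algorithm that, for each $\nu$, selects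 $$f^\nu\in\epsilon^\nu\text{-}\mathrm{argmin}_{f\in F^\nu}\ \frac1n\sum_{j=1}^n\psi(x^j,f)+\pi^\nu(f).$$ (i) If $\epsilon^\infty\le\epsilon$, then every cluster point of $(f^\nu)$ belongs to $\epsilon\text{-}\mathrm{argmin}_{f\in F}\ \frac1n\sum_{j=1}^n\psi(x^j,f)+\pi(f)$. (ii) If $\epsilon^\infty<\epsilon$, $F^\nu\subset F$ for all $\nu$, and there exist $g\in F$ and $(x,\alpha)\in S\times\mathbb{R}$ such that $f(x)\ge\alpha$ for all $f\in F^0$ and $\psi(x^j,g)<\infty$ for all $j$, then $f^{\bar\nu}\in\epsilon\text{-}\mathrm{argmin}_{f\in F}\ \frac1n\sum_{j=1}^n\psi(x^j,f)+\pi(f)$ for some $\bar\nu\in\mathbb{N}$. -/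

import Mathlib

open Set Filter Topology MeasureTheory

noncomputable section

/-- The extended real-valued upper semicontinuous functions on `S ⊆ ℝ^d` that are not identically
`-∞`. The parameter `c` is the centre point in `S × ℝ` from which the aw-distance is measured; it
plays no role in which functions belong to the space. -/
@[ext]
structure UscFcn {d : ℕ} (S : Set (EuclideanSpace ℝ (Fin d))) (c : S × ℝ) where
  toFun : S → EReal
  usc : UpperSemicontinuous toFun
  ne_bot : ∃ x, toFun x ≠ ⊥

namespace UscFcn

variable {d : ℕ} {S : Set (EuclideanSpace ℝ (Fin d))} {c : S × ℝ}

instance : CoeFun (UscFcn S c) (fun _ => S → EReal) := ⟨UscFcn.toFun⟩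

/-- The hypograph `{(x, α) ∈ S × ℝ | α ≤ f x}`, as a subset of `ℝ^d × ℝ`. -/
def hypo (f : UscFcn S c) : Set (EuclideanSpace ℝ (Fin d) × ℝ) :=
  {p | ∃ h : p.1 ∈ S, (p.2 : EReal) ≤ f ⟨p.1, h⟩}

/-- The centre point, as a point of `ℝ^d × ℝ`. -/
def centre (c : S × ℝ) : EuclideanSpace ℝ (Fin d) × ℝ := ((c.1 : EuclideanSpace ℝ (Fin d)), c.2)

/-- The `ρ`-aw-distance: the largest difference of the distances to the two hypographs over the
closed ball of radius `ρ` around the centre. The norm on `ℝ^d × ℝ` is `max ‖x‖₂ |α|`. -/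
def awDistAt (ρ : ℝ) (f g : UscFcn S c) : ℝ :=
  ⨆ p : Metric.closedBall (centre c) ρ,
    |Metric.infDist p.1 f.hypo - Metric.infDist p.1 g.hypo|

/-- The aw-distance (Attouch-Wets distance). -/
def awDist (f g : UscFcn S c) : ℝ :=
  ∫ ρ in Ioi (0 : ℝ), awDistAt ρ f g * Real.exp (-ρ)

theorem abs_sub_infDist_le (f g : UscFcn S c) (ρ : ℝ) (p : Metric.closedBall (centre c) ρ) :
    |Metric.infDist p.1 f.hypo - Metric.infDist p.1 g.hypo| ≤
      Metric.infDist (centre c) f.hypo + Metric.infDist (centre c) g.hypo + ρ := by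
  have hp := Metric.mem_closedBall.1 p.2
  have h1 := Metric.infDist_le_infDist_add_dist (s := f.hypo) (x := p.1) (y := centre c)
  have h2 := Metric.infDist_le_infDist_add_dist (s := g.hypo) (x := p.1) (y := centre c)
  have h3 := Metric.infDist_nonneg (x := p.1) (s := f.hypo)
  have h4 := Metric.infDist_nonneg (x := p.1) (s := g.hypo)
  have h5 := Metric.infDist_nonneg (x := centre c) (s := f.hypo)
  have h6 := Metric.infDist_nonneg (x := centre c) (s := g.hypo)
  rw [abs_le]
  constructor <;> linarith

theorem bddAbove_awDistAt (f g : UscFcn S c) (ρ : ℝ) :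
    BddAbove (range fun p : Metric.closedBall (centre c) ρ =>
      |Metric.infDist p.1 f.hypo - Metric.infDist p.1 g.hypo|) :=
  ⟨_, by rintro _ ⟨p, rfl⟩; exact abs_sub_infDist_le f g ρ p⟩

theorem awDistAt_nonneg (ρ : ℝ) (f g : UscFcn S c) : 0 ≤ awDistAt ρ f g :=
  Real.iSup_nonneg fun _ => abs_nonneg _

theorem le_awDistAt {ρ : ℝ} (f g : UscFcn S c) {p : EuclideanSpace ℝ (Fin d) × ℝ}
    (hp : p ∈ Metric.closedBall (centre c) ρ) :
    |Metric.infDist p f.hypo - Metric.infDist p g.hypo| ≤ awDistAt ρ f g :=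
  le_ciSup (bddAbove_awDistAt f g ρ) ⟨p, hp⟩

theorem awDistAt_mono (f g : UscFcn S c) : Monotone fun ρ => awDistAt ρ f g := fun _ _ h =>
  Real.iSup_le (fun p => le_awDistAt f g (Metric.closedBall_subset_closedBall h p.2))
    (awDistAt_nonneg _ f g)

theorem awDistAt_triangle (ρ : ℝ) (f g h : UscFcn S c) :
    awDistAt ρ f h ≤ awDistAt ρ f g + awDistAt ρ g h :=
  Real.iSup_le (fun p => (abs_sub_le _ _ _).trans
    (add_le_add (le_awDistAt f g p.2) (le_awDistAt g h p.2)))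
    (add_nonneg (awDistAt_nonneg _ _ _) (awDistAt_nonneg _ _ _))

theorem integrableOn_awDistAt (f g : UscFcn S c) :
    IntegrableOn (fun ρ => awDistAt ρ f g * Real.exp (-ρ)) (Ioi 0) := by
  have h1 := Real.GammaIntegral_convergent (s := 1) one_pos
  have h2 := Real.GammaIntegral_convergent (s := 2) two_pos
  refine Integrable.mono' ((h1.const_mul (Metric.infDist (centre c) f.hypo +
    Metric.infDist (centre c) g.hypo)).add h2) ?_ ?_
  · exact (((awDistAt_mono f g).measurable).mul (by fun_prop)).aestronglyMeasurable
  · filter_upwards [ae_restrict_mem measurableSet_Ioi] with ρ hρ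
    have hρ' : (0 : ℝ) ≤ ρ := le_of_lt hρ
    have hb : awDistAt ρ f g ≤ Metric.infDist (centre c) f.hypo +
        Metric.infDist (centre c) g.hypo + ρ :=
      Real.iSup_le (fun p => abs_sub_infDist_le f g ρ p)
        (add_nonneg (add_nonneg Metric.infDist_nonneg Metric.infDist_nonneg) hρ')
    rw [Real.norm_of_nonneg (mul_nonneg (awDistAt_nonneg _ _ _) (Real.exp_pos _).le)]
    have he : (2 : ℝ) - 1 = 1 := by norm_num
    simp only [Pi.add_apply, sub_self, Real.rpow_zero, mul_one, he, Real.rpow_one]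
    nlinarith [mul_le_mul_of_nonneg_right hb (Real.exp_pos (-ρ)).le]

theorem mem_hypo_of_mem_closure (f : UscFcn S c) {p : EuclideanSpace ℝ (Fin d) × ℝ}
    (hS : p.1 ∈ S) (hp : p ∈ closure f.hypo) : p ∈ f.hypo := by
  refine ⟨hS, ?_⟩
  by_contra! hlt
  obtain ⟨r, hr1, hr2⟩ := EReal.lt_iff_exists_real_btwn.1 hlt
  have hu := f.usc ⟨p.1, hS⟩ r hr1
  rw [nhds_subtype_eq_comap, eventually_comap] at hu
  have h1 : ∀ᶠ q in 𝓝 p, ∀ a : S, (a : EuclideanSpace ℝ (Fin d)) = q.1 → f a < r :=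
    (continuous_fst.tendsto p).eventually hu
  have h2 : ∀ᶠ q : EuclideanSpace ℝ (Fin d) × ℝ in 𝓝 p, r < q.2 :=
    (continuous_snd.tendsto p).eventually (eventually_gt_nhds (EReal.coe_lt_coe_iff.1 hr2))
  obtain ⟨q, ⟨hq, hle⟩, hq1, hq2⟩ :=
    ((mem_closure_iff_frequently.1 hp).and_eventually (h1.and h2)).exists
  exact absurd (hle.trans_lt (hq1 ⟨q.1, hq⟩ rfl))
    (not_lt.2 (EReal.coe_le_coe_iff.2 hq2.le))

theorem hypo_nonempty (f : UscFcn S c) : f.hypo.Nonempty := by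
  obtain ⟨x, hx⟩ := f.ne_bot
  obtain ⟨r, -, hr⟩ := EReal.lt_iff_exists_real_btwn.1 (bot_lt_iff_ne_bot.2 hx)
  exact ⟨((x : EuclideanSpace ℝ (Fin d)), r), x.2, hr.le⟩

theorem hypo_subset_of_infDist_eq {f g : UscFcn S c}
    (h : ∀ p, Metric.infDist p f.hypo = Metric.infDist p g.hypo) : f.hypo ⊆ g.hypo := by
  intro p hp
  refine mem_hypo_of_mem_closure g hp.1 ?_
  rw [Metric.mem_closure_iff_infDist_zero g.hypo_nonempty, ← h p]
  exact Metric.infDist_zero_of_mem hp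

theorem le_of_hypo_subset {f g : UscFcn S c} (h : f.hypo ⊆ g.hypo) (x : S) : f x ≤ g x := by
  by_contra! hlt
  obtain ⟨r, hr1, hr2⟩ := EReal.lt_iff_exists_real_btwn.1 hlt
  obtain ⟨_, hle⟩ := h (show ((x : EuclideanSpace ℝ (Fin d)), r) ∈ f.hypo from ⟨x.2, hr2.le⟩)
  exact absurd hr1 (not_lt.2 hle)

theorem eq_of_awDist_eq_zero {f g : UscFcn S c} (h : awDist f g = 0) : f = g := by
  have h0 := (setIntegral_eq_zero_iff_of_nonneg_ae (ae_of_all _ fun ρ =>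
    mul_nonneg (awDistAt_nonneg ρ f g) (Real.exp_pos (-ρ)).le) (integrableOn_awDistAt f g)).1 h
  have hz : ∀ ρ, awDistAt ρ f g = 0 := by
    intro ρ
    by_contra hne
    have hpos : 0 < awDistAt ρ f g := lt_of_le_of_ne (awDistAt_nonneg ρ f g) (Ne.symm hne)
    have h1 := (ae_restrict_iff' measurableSet_Ioi).1 h0
    have h2 : volume (Ioi (max ρ 0)) = 0 := by
      refine measure_mono_null ?_ (ae_iff.1 h1)
      intro t ht hcon
      have ht' := max_lt_iff.1 (mem_Ioi.1 ht)
      have h3 := hcon ht'.2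
      have h4 : 0 < awDistAt t f g := hpos.trans_le (awDistAt_mono f g ht'.1.le)
      exact absurd h3 (mul_pos h4 (Real.exp_pos (-t))).ne'
    simp at h2
  have hd : ∀ p, Metric.infDist p f.hypo = Metric.infDist p g.hypo := by
    intro p
    have h5 := le_awDistAt f g (Metric.mem_closedBall.2 (le_refl (dist p (centre c))))
    rw [hz] at h5
    exact sub_eq_zero.1 (abs_nonpos_iff.1 h5)
  ext x
  exact le_antisymm (le_of_hypo_subset (hypo_subset_of_infDist_eq hd) x)
    (le_of_hypo_subset (hypo_subset_of_infDist_eq fun p => (hd p).symm) x)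

/-- The space of usc functions on `S` with the aw-distance. -/
instance : MetricSpace (UscFcn S c) where
  dist := awDist
  dist_self f := by simp [awDist, awDistAt]
  dist_comm f g := by simp only [awDist, awDistAt, abs_sub_comm]
  dist_triangle f g h := by
    rw [awDist, awDist, awDist, ← integral_add (integrableOn_awDistAt f g)
      (integrableOn_awDistAt g h)]
    refine integral_mono (integrableOn_awDistAt f h)
      ((integrableOn_awDistAt f g).add (integrableOn_awDistAt g h)) fun ρ => ?_
    have := mul_le_mul_of_nonneg_right (awDistAt_triangle ρ f g h) (Real.exp_pos (-ρ)).le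
    simpa [add_mul] using this
  eq_of_dist_eq_zero h := eq_of_awDist_eq_zero h

end UscFcn

/-- Outer limit: the limits of convergent subsequences `a_k ∈ A (σ k)`. -/
def outLim {X : Type*} [TopologicalSpace X] (A : ℕ → Set X) : Set X :=
  {a | ∃ σ : ℕ → ℕ, StrictMono σ ∧ ∃ u : ℕ → X, (∀ k, u k ∈ A (σ k)) ∧ Tendsto u atTop (𝓝 a)}

/-- Inner limit: the limits of convergent sequences `a_k ∈ A k` (for all large `k`). -/
def innLim {X : Type*} [TopologicalSpace X] (A : ℕ → Set X) : Set X :=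
  {a | ∃ u : ℕ → X, (∀ᶠ k in atTop, u k ∈ A k) ∧ Tendsto u atTop (𝓝 a)}

/-- Set-convergence (Painlevé-Kuratowski): the inner and the outer limit both equal `B`. -/
def SetConverges {X : Type*} [TopologicalSpace X] (A : ℕ → Set X) (B : Set X) : Prop :=
  outLim A = B ∧ innLim A = B

/-- The `ε`-minimizers of `φ` over `F`. -/
def epsArgmin {X : Type*} (ε : ℝ) (F : Set X) (φ : X → EReal) : Set X :=
  {f | f ∈ F ∧ φ f ≤ (⨅ g ∈ F, φ g) + (ε : EReal)}

/-- The objective `f ↦ (1/n) ∑ⱼ ψ(xʲ, f) + π(f)`. -/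
def objective {D X : Type*} {n : ℕ} (ψ : D → X → EReal) (x : Fin n → D) (π : X → ℝ) (f : X) :
    EReal :=
  (((1 : ℝ) / (n : ℝ) : ℝ) : EReal) * ∑ j, ψ (x j) f + (π f : EReal)

/-- `f` is a sequence of iterates of the Estimation Algorithm: in iteration `ν`, an
`ε ν`-minimizer over the approximating class `F ν` of the objective with penalty `π ν`. -/
def IsAlgorithmSequence {D X : Type*} {n : ℕ} (ψ : D → X → EReal) (x : Fin n → D)
    (π : ℕ → X → ℝ) (F : ℕ → Set X) (ε : ℕ → ℝ) (f : ℕ → X) : Prop :=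
  ∀ ν, f ν ∈ epsArgmin (ε ν) (F ν) (objective ψ x (π ν))

end

/-! ### Compactness in the aw-distance -/

namespace UscFcn

/-! For (i), take a subsequence converging to the cluster point: the outer limit puts the point in
`F`. The inner limit gives each competitor in `F` a recovery sequence from the approximating
classes. Near-optimality along the subsequence passes to the limit, because the objectives converge
jointly in index and argument.

For (ii), the iterates have a common point in their hypographs, which forces a cluster point. Along
an ultrafilter the bounded distances `infDist p` converge for every `p`. The limit is again the
distance function of a hypograph (`exists_infDist_hypo_eq_of_tendsto`), and pointwise convergence of
distances upgrades to the aw-distance (`tendsto_of_tendsto_infDist`). By (i) the cluster point is an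
`εinf`-minimizer. The infimum is finite, so `εinf < ε` leaves a strict gap. The limit objective is
continuous on `F₀`, since continuous convergence makes the limit penalty continuous, so some iterate
lies within the gap. -/

/-- A nonempty closed set over `S` that is downward closed in its last coordinate is a hypograph. -/
theorem exists_hypo_eq {d : ℕ} {S : Set (EuclideanSpace ℝ (Fin d))} {c : S × ℝ}
    {C : Set (EuclideanSpace ℝ (Fin d) × ℝ)} (hC : IsClosed C) (hne : C.Nonempty)
    (hCS : ∀ p ∈ C, p.1 ∈ S) (hdown : ∀ p ∈ C, ∀ β ≤ p.2, (p.1, β) ∈ C) :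
    ∃ f : UscFcn S c, f.hypo = C := by
  set F : S → EReal := fun x => ⨆ (α : ℝ) (_ : ((x : EuclideanSpace ℝ (Fin d)), α) ∈ C), (α : EReal)
  have hF : ∀ (x : S) (r : ℝ), (r : EReal) ≤ F x ↔ ((x : EuclideanSpace ℝ (Fin d)), r) ∈ C := by
    intro x r
    refine ⟨fun h => ?_, fun h => le_iSup₂ (f := fun (α : ℝ) (_ : (x.1, α) ∈ C) => (α : EReal)) r h⟩
    -- Downward closure gives every height below the supremum; closedness then adds the supremum
    -- itself.
    have hlt : ∀ β < r, ((x : EuclideanSpace ℝ (Fin d)), β) ∈ C := by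
      intro β hβ
      obtain ⟨α, hα⟩ := lt_iSup_iff.1 ((EReal.coe_lt_coe_iff.2 hβ).trans_le h)
      obtain ⟨hαC, hβα⟩ := lt_iSup_iff.1 hα
      exact hdown _ hαC β (EReal.coe_lt_coe_iff.1 hβα).le
    have ht : Tendsto (fun β : ℝ => ((x : EuclideanSpace ℝ (Fin d)), β)) (𝓝[<] r) (𝓝 (x.1, r)) :=
      ((Continuous.prodMk_right x.1).tendsto r).mono_left nhdsWithin_le_nhds
    exact hC.mem_of_tendsto ht (eventually_nhdsWithin_of_forall hlt)
  refine ⟨⟨F, ?_, ?_⟩, ?_⟩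
  · intro x a ha
    obtain ⟨r, hr1, hr2⟩ := EReal.lt_iff_exists_real_btwn.1 ha
    have hx : ((x : EuclideanSpace ℝ (Fin d)), r) ∉ C := fun h =>
      absurd hr1 (not_lt.2 ((hF x r).2 h))
    have hcont : Continuous fun z : S => ((z : EuclideanSpace ℝ (Fin d)), r) := by fun_prop
    filter_upwards [hcont.continuousAt.eventually_mem (hC.isOpen_compl.mem_nhds hx)] with z hz
    exact (not_le.1 fun h => hz ((hF z r).1 h)).trans hr2
  · obtain ⟨p, hp⟩ := hne
    exact ⟨⟨p.1, hCS p hp⟩, ((EReal.bot_lt_coe p.2).trans_le ((hF ⟨p.1, hCS p hp⟩ p.2).2 hp)).ne'⟩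
  · ext p
    exact ⟨fun ⟨h, hle⟩ => (hF ⟨p.1, h⟩ p.2).1 hle,
      fun h => ⟨hCS p h, (hF ⟨p.1, hCS p h⟩ p.2).2 h⟩⟩

variable {d : ℕ} {S : Set (EuclideanSpace ℝ (Fin d))} {c : S × ℝ}

theorem isClosed_hypo (hS : IsClosed S) (f : UscFcn S c) : IsClosed f.hypo := by
  refine isClosed_of_closure_subset fun p hp => mem_hypo_of_mem_closure f ?_ hp
  have hsub : f.hypo ⊆ Prod.fst ⁻¹' S := fun q hq => hq.1
  exact closure_minimal hsub (hS.preimage continuous_fst) hp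

theorem hypo_downward (f : UscFcn S c) {p : EuclideanSpace ℝ (Fin d) × ℝ} (hp : p ∈ f.hypo)
    {β : ℝ} (hβ : β ≤ p.2) : (p.1, β) ∈ f.hypo :=
  ⟨hp.1, (EReal.coe_le_coe_iff.2 hβ).trans hp.2⟩

/-- If the distance functions of hypographs through a common point converge pointwise along an
ultrafilter, then the limit is the distance function of a hypograph. -/
theorem exists_infDist_hypo_eq_of_tendsto {ι : Type*} (hS : IsClosed S) (U : Ultrafilter ι)
    (u : ι → UscFcn S c) {p₀ : EuclideanSpace ℝ (Fin d) × ℝ} (hp₀ : ∀ i, p₀ ∈ (u i).hypo)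
    {D : EuclideanSpace ℝ (Fin d) × ℝ → ℝ}
    (hD : ∀ p, Tendsto (fun i => Metric.infDist p (u i).hypo) U (𝓝 (D p))) :
    ∃ f : UscFcn S c, p₀ ∈ f.hypo ∧ ∀ p, Metric.infDist p f.hypo = D p := by
  have hnear : ∀ p i, ∃ q ∈ (u i).hypo, Metric.infDist p (u i).hypo = dist p q := fun p i =>
    (isClosed_hypo hS (u i)).exists_infDist_eq_dist (hypo_nonempty _) p
  choose q hq hqd using hnear
  have hDle : ∀ p p', D p ≤ D p' + dist p p' := fun p p' =>
    le_of_tendsto_of_tendsto' (hD p) ((hD p').add_const _) fun _ =>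
      Metric.infDist_le_infDist_add_dist
  have hD0 : ∀ p, 0 ≤ D p := fun p => ge_of_tendsto' (hD p) fun _ => Metric.infDist_nonneg
  have hDcont : Continuous D := by
    refine LipschitzWith.continuous (K := 1) (LipschitzWith.of_le_add fun p p' => hDle p p')
  -- The nearest points to `p` stay in a fixed ball thanks to `p₀`; their limit is a zero of `D` at
  -- distance `D p`. Hence `D` is the distance to its zero set.
  have hproj : ∀ p, ∃ r, D r = 0 ∧ dist p r = D p := by
    intro p
    have hmem : ∀ i, q p i ∈ Metric.closedBall p (dist p p₀) := fun i => by
      rw [Metric.mem_closedBall, dist_comm, ← hqd p i]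
      exact Metric.infDist_le_dist_of_mem (hp₀ i)
    obtain ⟨r, -, hr⟩ := (isCompact_closedBall p (dist p p₀)).ultrafilter_le_nhds
      (U.map (q p)) (by
        rw [le_principal_iff]
        exact Filter.mem_map.2 (univ_mem' hmem))
    have hr' : Tendsto (q p) U (𝓝 r) := hr
    refine ⟨r, le_antisymm ?_ (hD0 r), ?_⟩
    · have h0 : Tendsto (fun i => dist r (q p i)) U (𝓝 0) := by
        simpa using (tendsto_const_nhds (x := r)).dist hr'
      exact le_of_tendsto_of_tendsto' (hD r) h0 fun i =>
        Metric.infDist_le_dist_of_mem (hq p i)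
    · refine tendsto_nhds_unique ((tendsto_const_nhds (x := p)).dist hr') ?_
      simpa only [hqd p] using hD p
  -- Zeros of `D` are limits of hypograph points, so they inherit both lying over `S` and downward
  -- closure.
  have hlim : ∀ p, D p = 0 → Tendsto (q p) U (𝓝 p) := fun p hp => by
    rw [tendsto_iff_dist_tendsto_zero, ← hp]
    refine (hD p).congr fun i => ?_
    rw [hqd p i, dist_comm]
  have hp₀D : D p₀ = 0 := by
    refine tendsto_nhds_unique (hD p₀) ?_
    simp only [Metric.infDist_zero_of_mem (hp₀ _)]
    exact tendsto_const_nhds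
  obtain ⟨f, hf⟩ := exists_hypo_eq (c := c) (C := {p | D p = 0})
    (isClosed_eq hDcont continuous_const) ⟨p₀, hp₀D⟩
    (fun p hp => hS.mem_of_tendsto ((continuous_fst.tendsto p).comp (hlim p hp))
      (Eventually.of_forall fun i => (hq p i).1))
    (fun p hp β hβ => by
      have h1 : Tendsto (fun i => ((q p i).1, (q p i).2 - (p.2 - β))) U (𝓝 (p.1, β)) := by
        have h2 := hlim p hp
        have h3 : Tendsto (fun i => (q p i).2 - (p.2 - β)) U (𝓝 (p.2 - (p.2 - β))) :=
          ((continuous_snd.tendsto p).comp h2).sub_const _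
        rw [sub_sub_cancel] at h3
        exact ((continuous_fst.tendsto p).comp h2).prodMk_nhds h3
      have h4 : Tendsto (fun i => dist (p.1, β) ((q p i).1, (q p i).2 - (p.2 - β))) U (𝓝 0) := by
        simpa using (tendsto_const_nhds (x := (p.1, β))).dist h1
      exact le_antisymm (le_of_tendsto_of_tendsto' (hD _) h4 fun i =>
        Metric.infDist_le_dist_of_mem (hypo_downward (u i) (hq p i) (by linarith))) (hD0 _))
  refine ⟨f, hf ▸ hp₀D, fun p => le_antisymm ?_ ?_⟩
  · obtain ⟨r, hr, hpr⟩ := hproj p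
    rw [← hpr, hf]
    exact Metric.infDist_le_dist_of_mem hr
  · refine (Metric.le_infDist (hypo_nonempty f)).2 fun r hr => ?_
    rw [hf] at hr
    simpa [show D r = 0 from hr] using hDle p r

theorem integrableOn_pow_mul_exp_neg (k : ℕ) :
    IntegrableOn (fun ρ : ℝ => ρ ^ k * Real.exp (-ρ)) (Ioi 0) := by
  have h := Real.GammaIntegral_convergent (s := k + 1) (by positivity)
  refine h.congr_fun (fun ρ _ => ?_) measurableSet_Ioi
  simp [mul_comm]

theorem integral_pow_mul_exp_neg (k : ℕ) :
    ∫ ρ in Ioi (0 : ℝ), ρ ^ k * Real.exp (-ρ) = k.factorial := by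
  rw [← Real.Gamma_nat_eq_factorial, Real.Gamma_eq_integral (by positivity)]
  refine setIntegral_congr_fun measurableSet_Ioi fun ρ _ => ?_
  simp [mul_comm]

/-- The aw-distance is controlled by the `R`-aw-distance, up to an error of order `1 / R`. -/
theorem awDist_le (f g : UscFcn S c) {R : ℝ} (hR : 0 < R) :
    awDist f g ≤ awDistAt R f g + (Metric.infDist (centre c) f.hypo +
      Metric.infDist (centre c) g.hypo + 2) / R := by
  set K := Metric.infDist (centre c) f.hypo + Metric.infDist (centre c) g.hypo with hK
  have hK0 : 0 ≤ K := add_nonneg Metric.infDist_nonneg Metric.infDist_nonneg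
  have i0 := (integrableOn_pow_mul_exp_neg 0).const_mul (awDistAt R f g)
  have i1 := (integrableOn_pow_mul_exp_neg 1).const_mul (K / R)
  have i2 := (integrableOn_pow_mul_exp_neg 2).const_mul (1 / R)
  have hle : awDist f g ≤ ∫ ρ in Ioi (0 : ℝ), (awDistAt R f g * (ρ ^ 0 * Real.exp (-ρ)) +
      K / R * (ρ ^ 1 * Real.exp (-ρ)) + 1 / R * (ρ ^ 2 * Real.exp (-ρ))) := by
    refine setIntegral_mono_on (integrableOn_awDistAt f g) ((i0.add i1).add i2)
      measurableSet_Ioi fun ρ hρ => ?_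
    have hρ0 : 0 < ρ := hρ
    -- Monotonicity covers `ρ ≤ R`. Beyond `R` the bound `K + ρ` may be multiplied by `ρ / R ≥ 1`.
    -- Integrating against `exp (-ρ)` uses the moments `0!`, `1!`, `2!`.
    have hb : awDistAt ρ f g ≤ awDistAt R f g + K / R * ρ + 1 / R * ρ ^ 2 := by
      rcases le_total ρ R with h | h
      · have := awDistAt_mono f g h
        have h1 : 0 ≤ K / R * ρ + 1 / R * ρ ^ 2 := by positivity
        dsimp only at this
        linarith
      · have h1 : awDistAt ρ f g ≤ K + ρ :=
          Real.iSup_le (fun p => abs_sub_infDist_le f g ρ p) (by positivity)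
        have h2 : 1 ≤ ρ / R := (one_le_div hR).2 h
        have h3 : (K + ρ) * 1 ≤ (K + ρ) * (ρ / R) := mul_le_mul_of_nonneg_left h2 (by positivity)
        have h4 : (K + ρ) * (ρ / R) = K / R * ρ + 1 / R * ρ ^ 2 := by ring
        linarith [awDistAt_nonneg R f g]
    calc awDistAt ρ f g * Real.exp (-ρ)
        ≤ (awDistAt R f g + K / R * ρ + 1 / R * ρ ^ 2) * Real.exp (-ρ) :=
          mul_le_mul_of_nonneg_right hb (Real.exp_pos _).le
      _ = _ := by ring
  refine hle.trans (le_of_eq ?_)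
  have i01 : IntegrableOn (fun ρ : ℝ => awDistAt R f g * (ρ ^ 0 * Real.exp (-ρ)) +
      K / R * (ρ ^ 1 * Real.exp (-ρ))) (Ioi 0) := i0.add i1
  rw [integral_add i01 i2, integral_add i0 i1, integral_const_mul, integral_const_mul,
    integral_const_mul, integral_pow_mul_exp_neg, integral_pow_mul_exp_neg,
    integral_pow_mul_exp_neg]
  simp [Nat.factorial]
  ring

/-- Pointwise convergence of the distance functions is uniform on bounded sets. -/
theorem eventually_awDistAt_le {ι : Type*} {l : Filter ι} {u : ι → UscFcn S c} {f : UscFcn S c}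
    (h : ∀ p, Tendsto (fun i => Metric.infDist p (u i).hypo) l (𝓝 (Metric.infDist p f.hypo)))
    (R : ℝ) {η : ℝ} (hη : 0 < η) : ∀ᶠ i in l, awDistAt R (u i) f ≤ η := by
  -- Distance functions are 1-Lipschitz, so control on a finite `η / 3`-net suffices.
  obtain ⟨t, htf, ht⟩ := Metric.totallyBounded_iff.1
    (isCompact_closedBall (centre c) R).totallyBounded (η / 3) (by positivity)
  have hev : ∀ᶠ i in l, ∀ y ∈ t,
      |Metric.infDist y (u i).hypo - Metric.infDist y f.hypo| < η / 3 :=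
    (eventually_all_finite htf).2 fun y _ => by
      simpa only [Real.dist_eq] using Metric.tendsto_nhds.1 (h y) (η / 3) (by positivity)
  filter_upwards [hev] with i hi
  refine Real.iSup_le (fun p => ?_) hη.le
  obtain ⟨y, hyt, hy⟩ := mem_iUnion₂.1 (ht p.2)
  have hy' : dist p.1 y < η / 3 := hy
  have h1 := abs_lt.1 (hi y hyt)
  have h2 := Metric.infDist_le_infDist_add_dist (s := (u i).hypo) (x := p.1) (y := y)
  have h3 := Metric.infDist_le_infDist_add_dist (s := (u i).hypo) (x := y) (y := p.1)
  have h4 := Metric.infDist_le_infDist_add_dist (s := f.hypo) (x := p.1) (y := y)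
  have h5 := Metric.infDist_le_infDist_add_dist (s := f.hypo) (x := y) (y := p.1)
  rw [dist_comm y p.1] at h3 h5
  rw [abs_le]
  constructor <;> linarith

/-- Pointwise convergence of the distance functions of hypographs through a common point implies
convergence in the aw-distance. -/
theorem tendsto_of_tendsto_infDist {ι : Type*} {l : Filter ι} {u : ι → UscFcn S c}
    {f : UscFcn S c} {p₀ : EuclideanSpace ℝ (Fin d) × ℝ} (hu : ∀ i, p₀ ∈ (u i).hypo)
    (hf : p₀ ∈ f.hypo)
    (h : ∀ p, Tendsto (fun i => Metric.infDist p (u i).hypo) l (𝓝 (Metric.infDist p f.hypo))) :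
    Tendsto u l (𝓝 f) := by
  refine Metric.tendsto_nhds.2 fun η hη => ?_
  -- `K` bounds the numerator of the tail in `awDist_le` uniformly in `i`; the radius `4 * K / η`
  -- makes the tail at most `η / 4`.
  set K := 2 * dist (centre c) p₀ + 2
  have hK : 0 < K := by positivity
  have hR : 0 < 4 * K / η := by positivity
  filter_upwards [eventually_awDistAt_le h (4 * K / η) (half_pos hη)] with i hi
  have h1 : Metric.infDist (centre c) (u i).hypo ≤ dist (centre c) p₀ :=
    Metric.infDist_le_dist_of_mem (hu i)
  have h2 : Metric.infDist (centre c) f.hypo ≤ dist (centre c) p₀ :=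
    Metric.infDist_le_dist_of_mem hf
  have h3 : (Metric.infDist (centre c) (u i).hypo + Metric.infDist (centre c) f.hypo + 2) /
      (4 * K / η) ≤ K / (4 * K / η) :=
    div_le_div_of_nonneg_right (by simp only [K]; linarith) hR.le
  have h4 : K / (4 * K / η) = η / 4 := by field_simp
  have h5 : dist (u i) f ≤ _ := awDist_le (u i) f hR
  linarith

/-- Along an ultrafilter, usc functions whose hypographs share a point converge. -/
theorem exists_tendsto_ultrafilter {ι : Type*} (hS : IsClosed S) (U : Ultrafilter ι)
    (u : ι → UscFcn S c) {p₀ : EuclideanSpace ℝ (Fin d) × ℝ} (hp₀ : ∀ i, p₀ ∈ (u i).hypo) :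
    ∃ f, Tendsto u U (𝓝 f) := by
  have hlim : ∀ p, ∃ r, Tendsto (fun i => Metric.infDist p (u i).hypo) U (𝓝 r) := fun p => by
    have hmem : ∀ i, Metric.infDist p (u i).hypo ∈ Icc 0 (dist p p₀) := fun i =>
      ⟨Metric.infDist_nonneg, Metric.infDist_le_dist_of_mem (hp₀ i)⟩
    obtain ⟨r, -, hr⟩ := (isCompact_Icc (a := (0 : ℝ)) (b := dist p p₀)).ultrafilter_le_nhds
      (U.map fun i => Metric.infDist p (u i).hypo) (by
        rw [le_principal_iff]
        exact Filter.mem_map.2 (univ_mem' hmem))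
    exact ⟨r, hr⟩
  choose D hD using hlim
  obtain ⟨f, hf, hfD⟩ := exists_infDist_hypo_eq_of_tendsto hS U u hp₀ hD
  exact ⟨f, tendsto_of_tendsto_infDist hp₀ hf fun p => hfD p ▸ hD p⟩

end UscFcn

/-! ### Continuous convergence -/

section ContinuousConvergence

variable {X : Type*} [PseudoMetricSpace X]

/-- Sequential continuous convergence on a set is convergence along a product filter. -/
theorem tendsto_prod_nhdsWithin_of_seq {F₀ : Set X} {π : X → ℝ} {πs : ℕ → X → ℝ}
    (hπ : ∀ (u : ℕ → X) (g : X), (∀ ν, u ν ∈ F₀) →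
      Tendsto u atTop (𝓝 g) → Tendsto (fun ν => πs ν (u ν)) atTop (𝓝 (π g)))
    {g : X} (hg : g ∈ F₀) :
    Tendsto (fun w : ℕ × X => πs w.1 w.2) (atTop ×ˢ 𝓝[F₀] g) (𝓝 (π g)) := by
  classical
  refine tendsto_of_subseq_tendsto fun w hw => ?_
  have hw1 : Tendsto (fun k => (w k).1) atTop atTop := tendsto_fst.comp hw
  have hw2 : Tendsto (fun k => (w k).2) atTop (𝓝[F₀] g) := tendsto_snd.comp hw
  obtain ⟨φ, hφ, hφw⟩ := strictMono_subseq_of_tendsto_atTop hw1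
  have hv2 : Tendsto (fun k => (w (φ k)).2) atTop (𝓝[F₀] g) := hw2.comp hφ.tendsto_atTop
  set N : ℕ → ℕ := fun k => (w (φ k)).1
  have hN : StrictMono N := hφw
  set v : ℕ → X := fun k => (w (φ k)).2
  -- The hypothesis needs a sequence indexed by all `ν` and always in `F₀`, so the gaps, and the
  -- terms `v k` outside `F₀`, are filled with `g`.
  set u : ℕ → X := fun ν => if h : ∃ k, N k = ν ∧ v k ∈ F₀ then v h.choose else g
  have hu0 : ∀ ν, u ν ∈ F₀ := fun ν => by
    by_cases h : ∃ k, N k = ν ∧ v k ∈ F₀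
    · simpa only [u, dif_pos h] using h.choose_spec.2
    · simpa only [u, dif_neg h] using hg
  have huN : ∀ k, v k ∈ F₀ → u (N k) = v k := fun k hk => by
    have h : ∃ j, N j = N k ∧ v j ∈ F₀ := ⟨k, rfl, hk⟩
    have hj : h.choose = k := hN.injective h.choose_spec.1
    simp only [u, dif_pos h, hj]
  have hug : Tendsto u atTop (𝓝 g) := by
    refine tendsto_nhds.2 fun s hs hgs => ?_
    have hev : ∀ᶠ k in atTop, v k ∈ s :=
      (tendsto_nhdsWithin_iff.1 hv2).1.eventually_mem (hs.mem_nhds hgs)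
    obtain ⟨m, hm⟩ := eventually_atTop.1 hev
    filter_upwards [eventually_ge_atTop (N m)] with ν hν
    by_cases h : ∃ k, N k = ν ∧ v k ∈ F₀
    · have hk := h.choose_spec.1
      have : u ν = v h.choose := by simp only [u, dif_pos h]
      rw [mem_preimage, this]
      exact hm _ (hN.le_iff_le.1 (hν.trans_eq hk.symm))
    · simpa only [u, dif_neg h, mem_preimage] using hgs
  refine ⟨φ, ((hπ u g hu0 hug).comp hN.tendsto_atTop).congr' ?_⟩
  filter_upwards [(tendsto_nhdsWithin_iff.1 hv2).2] with k hk
  simp only [Function.comp, huN k hk, N, v]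

/-- The limit of a continuously convergent sequence of functions is continuous. -/
theorem continuousWithinAt_of_tendsto_prod {F₀ : Set X} {π : X → ℝ} {πs : ℕ → X → ℝ}
    {g : X} (hpt : ∀ f ∈ F₀, Tendsto (fun ν => πs ν f) atTop (𝓝 (π f)))
    (h : Tendsto (fun w : ℕ × X => πs w.1 w.2) (atTop ×ˢ 𝓝[F₀] g) (𝓝 (π g))) :
    ContinuousWithinAt π F₀ g := by
  refine Metric.tendsto_nhds.2 fun η hη => ?_
  -- For `f` near `g` the bound holds for all large `ν`; let `ν → ∞` with `f` fixed.
  obtain ⟨P, hP, Q, hQ, hPQ⟩ := eventually_prod_iff.1 (Metric.tendsto_nhds.1 h (η / 2) (half_pos hη))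
  filter_upwards [hQ, self_mem_nhdsWithin] with f hf hfF
  have := le_of_tendsto ((hpt f hfF).dist (tendsto_const_nhds (x := π g)))
    (hP.mono fun ν hν => (hPQ hν hf).le)
  linarith

end ContinuousConvergence

/-! ### Extended-real arithmetic and the objective -/

namespace EReal

/-- Addition is discontinuous only where `⊤` meets `⊥`, so the induction must also carry that
partial sums avoid `⊥`. -/
theorem tendsto_sum_of_ne_bot {ι κ : Type*} {l : Filter ι} (s : Finset κ) {a : κ → ι → EReal}
    {b : κ → EReal} (h : ∀ j ∈ s, Tendsto (a j) l (𝓝 (b j))) (hb : ∀ j ∈ s, b j ≠ ⊥) :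
    Tendsto (fun i => ∑ j ∈ s, a j i) l (𝓝 (∑ j ∈ s, b j)) ∧ ∑ j ∈ s, b j ≠ ⊥ := by
  classical
  induction s using Finset.induction_on with
  | empty => simp [tendsto_const_nhds]
  | insert k s hk ih =>
    obtain ⟨ih1, ih2⟩ := ih (fun j hj => h j (Finset.mem_insert_of_mem hj))
      fun j hj => hb j (Finset.mem_insert_of_mem hj)
    have hbk := hb k (Finset.mem_insert_self k s)
    simp only [Finset.sum_insert hk]
    exact ⟨(continuousAt_add (p := (b k, ∑ j ∈ s, b j)) (.inr ih2) (.inl hbk)).tendsto.comp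
      ((h k (Finset.mem_insert_self k s)).prodMk_nhds ih1), by simp [EReal.add_eq_bot_iff, hbk, ih2]⟩

theorem tendsto_add_coe {ι : Type*} {l : Filter ι} {a : ι → EReal} {b : EReal} {r : ι → ℝ} {s : ℝ}
    (ha : Tendsto a l (𝓝 b)) (hr : Tendsto r l (𝓝 s)) :
    Tendsto (fun i => a i + (r i : EReal)) l (𝓝 (b + (s : EReal))) :=
  (continuousAt_add (p := (b, (s : EReal))) (.inr (coe_ne_bot s)) (.inr (coe_ne_top s))).tendsto.comp
    (ha.prodMk_nhds ((continuous_coe_real_ereal.tendsto s).comp hr))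

end EReal

section Objective

variable {D X ι : Type*} {n : ℕ} {ψ : D → X → EReal} {x : Fin n → D}

theorem tendsto_objective (hn : 0 < n) {l : Filter ι} {p : ι → X → ℝ} {π : X → ℝ} {u : ι → X}
    {g : X} (hψ : ∀ j, Tendsto (fun i => ψ (x j) (u i)) l (𝓝 (ψ (x j) g)))
    (hbot : ∀ j, ψ (x j) g ≠ ⊥) (hp : Tendsto (fun i => p i (u i)) l (𝓝 (π g))) :
    Tendsto (fun i => objective ψ x (p i) (u i)) l (𝓝 (objective ψ x π g)) := by
  -- Multiplication is discontinuous at `(0, ⊤)`, hence the need for `0 < n`.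
  have hc : (((1 : ℝ) / (n : ℝ) : ℝ) : EReal) ≠ 0 := by
    have : ((1 : ℝ) / (n : ℝ)) ≠ 0 := by positivity
    exact_mod_cast this
  have hsum := (EReal.tendsto_sum_of_ne_bot Finset.univ (fun j _ => hψ j) fun j _ => hbot j).1
  exact EReal.tendsto_add_coe ((EReal.tendsto_mul (.inl hc) (.inl hc) (.inl (EReal.coe_ne_bot _))
    (.inl (EReal.coe_ne_top _))).comp (tendsto_const_nhds.prodMk_nhds hsum)) hp

theorem objective_ne_bot {π : X → ℝ} {g : X} (hbot : ∀ j, ψ (x j) g ≠ ⊥) :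
    objective ψ x π g ≠ ⊥ := by
  -- Only the non-`⊥` half is wanted; along the filter `⊥` the convergence hypotheses are vacuous.
  have hsum := (EReal.tendsto_sum_of_ne_bot (l := (⊥ : Filter ℕ)) (a := fun _ _ => 0) Finset.univ
    (fun j _ => tendsto_bot) fun j (_ : j ∈ Finset.univ) => hbot j).2
  have hc : (0 : ℝ) ≤ (1 : ℝ) / (n : ℝ) := by positivity
  simp [objective, EReal.add_eq_bot_iff, EReal.mul_eq_bot, hsum, -one_div]
  exact fun h => absurd h (not_lt.2 (by exact_mod_cast hc))

theorem objective_lt_top {π : X → ℝ} {g : X} (htop : ∀ j, ψ (x j) g < ⊤) :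
    objective ψ x π g < ⊤ := by
  have hsum : ∑ j, ψ (x j) g < ⊤ := by
    refine Finset.sum_induction _ (· < ⊤) (fun a b ha hb => EReal.add_lt_top ha.ne hb.ne)
      EReal.zero_lt_top fun j _ => htop j
  have hc : (0 : ℝ) ≤ (1 : ℝ) / (n : ℝ) := by positivity
  refine EReal.add_lt_top ?_ (EReal.coe_ne_top _)
  simp [EReal.mul_eq_top, hsum.ne, -one_div]
  exact fun h => absurd h (not_lt.2 (by exact_mod_cast hc))

end Objective

/-! ### Near-minimizers -/

theorem mem_epsArgmin_of_forall {X : Type*} {ε : ℝ} {F : Set X} {φ : X → EReal} {f : X}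
    (hf : f ∈ F) (h : ∀ g ∈ F, φ f ≤ φ g + (ε : EReal)) : f ∈ epsArgmin ε F φ := by
  refine ⟨hf, ?_⟩
  have h1 : φ f - (ε : EReal) ≤ ⨅ g ∈ F, φ g := le_iInf₂ fun g hg =>
    EReal.sub_le_of_le_add (h g hg)
  have h2 := add_le_add_left h1 (ε : EReal)
  rwa [EReal.sub_add_cancel] at h2

theorem le_add_of_mem_epsArgmin {X : Type*} {ε : ℝ} {F : Set X} {φ : X → EReal} {f g : X}
    (hf : f ∈ epsArgmin ε F φ) (hg : g ∈ F) : φ f ≤ φ g + (ε : EReal) :=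
  hf.2.trans (add_le_add_left (iInf₂_le g hg) _)

section Algorithm

variable {D X : Type*} [PseudoMetricSpace X] {n : ℕ} {ψ : D → X → EReal} {x : Fin n → D}
  {F F₀ : Set X} {π : X → ℝ} {πs : ℕ → X → ℝ}

theorem tendsto_objective_of_continuous_convergence (hn : 0 < n)
    (hψ_bot : ∀ j, ∀ f ∈ F₀, ψ (x j) f ≠ ⊥) (hψ_cont : ∀ j, ContinuousOn (ψ (x j)) F₀)
    (hπ : ∀ (u : ℕ → X) (g : X), (∀ ν, u ν ∈ F₀) →
      Tendsto u atTop (𝓝 g) → Tendsto (fun ν => πs ν (u ν)) atTop (𝓝 (π g)))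
    {ι : Type*} {l : Filter ι} {N : ι → ℕ} {u : ι → X} {g : X} (hg : g ∈ F₀)
    (hN : Tendsto N l atTop) (hu : Tendsto u l (𝓝[F₀] g)) :
    Tendsto (fun i => objective ψ x (πs (N i)) (u i)) l (𝓝 (objective ψ x π g)) :=
  tendsto_objective hn (fun j => (hψ_cont j g hg).tendsto.comp hu) (fun j => hψ_bot j g hg)
    ((tendsto_prod_nhdsWithin_of_seq hπ hg).comp (hN.prodMk hu))

theorem continuousWithinAt_objective (hn : 0 < n)
    (hψ_bot : ∀ j, ∀ f ∈ F₀, ψ (x j) f ≠ ⊥) (hψ_cont : ∀ j, ContinuousOn (ψ (x j)) F₀)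
    (hπ : ∀ (u : ℕ → X) (g : X), (∀ ν, u ν ∈ F₀) →
      Tendsto u atTop (𝓝 g) → Tendsto (fun ν => πs ν (u ν)) atTop (𝓝 (π g)))
    {g : X} (hg : g ∈ F₀) : ContinuousWithinAt (objective ψ x π) F₀ g :=
  tendsto_objective (p := fun _ => π) hn (fun j => hψ_cont j g hg) (fun j => hψ_bot j g hg)
    (continuousWithinAt_of_tendsto_prod (fun f hf => hπ _ f (fun _ => hf) tendsto_const_nhds)
      (tendsto_prod_nhdsWithin_of_seq hπ hg))

/-- Cluster points of near-minimizers of the approximating problems are near-minimizers. -/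
theorem mem_epsArgmin_of_mapClusterPt (hn : 0 < n) (hFF₀ : F ⊆ F₀)
    (hψ_bot : ∀ j, ∀ f ∈ F₀, ψ (x j) f ≠ ⊥) (hψ_cont : ∀ j, ContinuousOn (ψ (x j)) F₀)
    (hπ : ∀ (u : ℕ → X) (g : X), (∀ ν, u ν ∈ F₀) →
      Tendsto u atTop (𝓝 g) → Tendsto (fun ν => πs ν (u ν)) atTop (𝓝 (π g)))
    {εinf : ℝ} {εs : ℕ → ℝ} (hεs : Tendsto εs atTop (𝓝 εinf))
    {Fs : ℕ → Set X} (hFsF₀ : ∀ ν, Fs ν ⊆ F₀) (hFs : SetConverges Fs F)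
    {fs : ℕ → X} (hfs : IsAlgorithmSequence ψ x πs Fs εs fs)
    {f : X} (hf : MapClusterPt f atTop fs) : f ∈ epsArgmin εinf F (objective ψ x π) := by
  obtain ⟨σ, hσ, hσf⟩ := hf.tendsto_subseq
  have hfF : f ∈ F := hFs.1 ▸ ⟨σ, hσ, fs ∘ σ, fun k => (hfs (σ k)).1, hσf⟩
  refine mem_epsArgmin_of_forall hfF fun g hg => ?_
  -- A recovery sequence for the competitor `g`.
  obtain ⟨u, hu, hug⟩ : g ∈ innLim Fs := hFs.2.symm ▸ hg
  have hσt := hσ.tendsto_atTop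
  have hlim_f := tendsto_objective_of_continuous_convergence hn hψ_bot hψ_cont hπ (hFF₀ hfF) hσt
    (tendsto_nhdsWithin_iff.2 ⟨hσf, Eventually.of_forall fun k => hFsF₀ _ (hfs (σ k)).1⟩)
  have hlim_g := tendsto_objective_of_continuous_convergence hn hψ_bot hψ_cont hπ (hFF₀ hg) hσt
    (tendsto_nhdsWithin_iff.2 ⟨hug.comp hσt, hσt.eventually (hu.mono fun ν h => hFsF₀ ν h)⟩)
  refine le_of_tendsto_of_tendsto hlim_f (EReal.tendsto_add_coe hlim_g (hεs.comp hσt)) ?_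
  filter_upwards [hσt.eventually hu] with k hk
  exact le_add_of_mem_epsArgmin (hfs (σ k)) hk

end Algorithm

theorem epsArgmin_mono {X : Type*} {ε ε' : ℝ} (h : ε ≤ ε') (F : Set X) (φ : X → EReal) :
    epsArgmin ε F φ ⊆ epsArgmin ε' F φ := fun _ hf =>
  ⟨hf.1, hf.2.trans (add_le_add_right (EReal.coe_le_coe_iff.2 h) _)⟩

theorem theorem5p1 {d d₀ n : ℕ} (hn : 0 < n)
    (S : Set (EuclideanSpace ℝ (Fin d))) (hS : IsClosed S) (c : S × ℝ)
    (x : Fin n → EuclideanSpace ℝ (Fin d₀))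
    (F F₀ : Set (UscFcn S c)) (hF : IsClosed F) (hF₀ : IsClosed F₀) (hFF₀ : F ⊆ F₀)
    (ψ : EuclideanSpace ℝ (Fin d₀) → UscFcn S c → EReal)
    (hψ_bot : ∀ j, ∀ f ∈ F₀, ψ (x j) f ≠ ⊥)
    (hψ_cont : ∀ j, ContinuousOn (ψ (x j)) F₀)
    (π : UscFcn S c → ℝ) (πs : ℕ → UscFcn S c → ℝ)
    (hπ : ∀ (u : ℕ → UscFcn S c) (g : UscFcn S c), (∀ ν, u ν ∈ F₀) →
      Tendsto u atTop (𝓝 g) → Tendsto (fun ν => πs ν (u ν)) atTop (𝓝 (π g)))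
    (ε εinf : ℝ) (εs : ℕ → ℝ) (hεs_nonneg : ∀ ν, 0 ≤ εs ν)
    (hεs : Tendsto εs atTop (𝓝 εinf))
    (Fs : ℕ → Set (UscFcn S c)) (hFsF₀ : ∀ ν, Fs ν ⊆ F₀) (hFs : SetConverges Fs F)
    (fs : ℕ → UscFcn S c) (hfs : IsAlgorithmSequence ψ x πs Fs εs fs) :
    (εinf ≤ ε → ∀ f, MapClusterPt f atTop fs → f ∈ epsArgmin ε F (objective ψ x π)) ∧
    (εinf < ε → (∀ ν, Fs ν ⊆ F) →
      (∃ g ∈ F, ∃ (y : S) (α : ℝ), (∀ f ∈ F₀, (α : EReal) ≤ f y) ∧ ∀ j, ψ (x j) g < ⊤) →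
      ∃ ν, fs ν ∈ epsArgmin ε F (objective ψ x π)) := by
  have hcluster : ∀ f, MapClusterPt f atTop fs → f ∈ epsArgmin εinf F (objective ψ x π) :=
    fun f => mem_epsArgmin_of_mapClusterPt hn hFF₀ hψ_bot hψ_cont hπ hεs hFsF₀ hFs hfs
  refine ⟨fun hε f hf => epsArgmin_mono hε _ _ (hcluster f hf), ?_⟩
  rintro hε hFsF ⟨g, hg, y, α, hα, hψg⟩
  have hfsF₀ : ∀ ν, fs ν ∈ F₀ := fun ν => hFsF₀ ν (hfs ν).1
  obtain ⟨f, hf⟩ := UscFcn.exists_tendsto_ultrafilter hS (Ultrafilter.of atTop) fs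
    (p₀ := ((y : EuclideanSpace ℝ (Fin d)), α)) fun ν => ⟨y.2, hα _ (hfsF₀ ν)⟩
  have hfmem := hcluster f (mapClusterPt_iff_ultrafilter.2 ⟨_, Ultrafilter.of_le _, hf⟩)
  have hbot : objective ψ x π f ≠ ⊥ := objective_ne_bot fun j => hψ_bot j f (hFF₀ hfmem.1)
  have htop : (⨅ h ∈ F, objective ψ x π h) ≠ ⊤ :=
    ((iInf₂_le g hg).trans_lt (objective_lt_top hψg)).ne
  -- An infimum `⊥` would absorb `εinf` and force the objective at `f` to be `⊥`.
  have hinf_bot : (⨅ h ∈ F, objective ψ x π h) ≠ ⊥ := fun h => by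
    have := hfmem.2
    rw [h, EReal.bot_add] at this
    exact hbot (le_bot_iff.1 this)
  have hlt : objective ψ x π f < (⨅ h ∈ F, objective ψ x π h) + (ε : EReal) := by
    refine hfmem.2.trans_lt ?_
    lift (⨅ h ∈ F, objective ψ x π h) to ℝ using ⟨htop, hinf_bot⟩ with m
    exact_mod_cast add_lt_add_right hε m
  -- Here the limit penalty `π` is evaluated at the iterates, so continuity of the limit objective
  -- is what matters.
  have hlim := (continuousWithinAt_objective hn hψ_bot hψ_cont hπ (hFF₀ hfmem.1)).tendsto.comp
    (tendsto_nhdsWithin_iff.2 ⟨hf, Eventually.of_forall hfsF₀⟩)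
  obtain ⟨ν, hν⟩ := (hlim.eventually_lt_const hlt).exists
  exact ⟨ν, hFsF ν (hfs ν).1, hν.le⟩
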